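/- Let $p\in(0,1)$ and $\mu,c,t>0$. Let $(M_s)_{s\ge 0}$ be a homogeneous Poisson process with intensity $p\mu$, and let $(W_n)_{n\ge1}$ be i.i.d. positive random variables with finite mean, independent of $(M_s)_{s\ge0}$, such that the net profit condition $p\mu\,\mathbb{E}[W_1]>c$ holds. For an initial capital $u\ge 0$ let $$R_s=u-c\,s+\sum_{n=1}^{M_s}W_n,\qquad s\ge0,$$ be the miner's surplus, $\tau_u=\inf\{s\ge0: R_s<0\}$ (with $\inf\emptyset=\infty$) the ruin time, $\psi(u,s)=\mathbb{P}(\tau_u\le s)$ the finite-time ruin probability, and $\widehat\psi(u,t)=\mathbb{E}[\psi(u,T)]$ the ruin probability up to a random time horizon $T$ that is exponentially distributed with mean $t$. Then the equation $$p\mu+\frac1t-cR=p\mu\,\mathbb{E}\big[e^{-RW_1}\big]$$ has exactly one positive root $R$, and for this $R$, which does not depend on $u$, $$\widehat\psi(u,t)=e^{-Ru}\qquad\text{for all }u\ge0.$$ -/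

import Mathlib

open MeasureTheory ProbabilityTheory
open scoped NNReal ENNReal

namespace MinerRuin

/-- `N` is a homogeneous Poisson process with intensity `r` under `P`: the counting process of
arrivals whose successive interarrival times `E 0, E 1, …` are independent and exponentially
distributed with rate `r`. The `n`-th arrival (counting from `0`) happens at time
`E 0 + ⋯ + E n`, and `N s` is almost surely, for all times `s` simultaneously, the number of
arrivals in `[0, s]`. -/
def IsPoissonProcess {Ω : Type*} [MeasurableSpace Ω] (N : ℝ≥0 → Ω → ℕ) (r : ℝ)
    (P : Measure Ω) : Prop :=
  (∀ s, Measurable (N s)) ∧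
    ∃ E : ℕ → Ω → ℝ,
      (∀ k, Measurable (E k)) ∧
      iIndepFun E P ∧
      (∀ k, P.map (E k) = expMeasure r) ∧
      ∀ᵐ ω ∂P, ∀ s : ℝ≥0,
        N s ω = Set.ncard {n : ℕ | ∑ k ∈ Finset.range (n + 1), E k ω ≤ (s : ℝ)}

/-- The surplus `u - c s + W₁ + ⋯ + W_{M s}` at time `s` (the rewards are indexed from `0`, so
`W 0` is the first one). -/
noncomputable def surplus {Ω : Type*} (M : ℝ≥0 → Ω → ℕ) (W : ℕ → Ω → ℝ) (c u : ℝ)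
    (s : ℝ≥0) (ω : Ω) : ℝ :=
  u - c * (s : ℝ) + ∑ k ∈ Finset.range (M s ω), W k ω

/-- The ruin time `inf {s ≥ 0 : R_s < 0}`, equal to `∞` when the surplus never becomes
negative. -/
noncomputable def ruinTime {Ω : Type*} (M : ℝ≥0 → Ω → ℕ) (W : ℕ → Ω → ℝ) (c u : ℝ)
    (ω : Ω) : ℝ≥0∞ :=
  ⨅ (s : ℝ≥0) (_ : surplus M W c u s ω < 0), (s : ℝ≥0∞)

/-- The finite-time ruin probability `ψ(u, s) = P(τ_u ≤ s)` (used for `s ≥ 0` only). -/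
noncomputable def ruinProb {Ω : Type*} [MeasurableSpace Ω] (P : Measure Ω)
    (M : ℝ≥0 → Ω → ℕ) (W : ℕ → Ω → ℝ) (c u s : ℝ) : ℝ :=
  P.real {ω | ruinTime M W c u ω ≤ ENNReal.ofReal s}

/-- The ruin probability `E[ψ(u, T)]` up to an exponential time horizon `T` with mean `t`, that
is, with rate `1 / t`. -/
noncomputable def expHorizonRuinProb {Ω : Type*} [MeasurableSpace Ω] (P : Measure Ω)
    (M : ℝ≥0 → Ω → ℕ) (W : ℕ → Ω → ℝ) (c u t : ℝ) : ℝ :=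
  ∫ s, ruinProb P M W c u s ∂(expMeasure (1 / t))

end MinerRuin

/-! Put `r = p * μ` and `δ = 1 / t`. An exponential horizon of rate `δ` exceeds an independent time
`τ` with probability `E[exp (-δ τ)]`, so the quantity sought is the Laplace transform of the ruin
time at `δ`. The surplus moves down only by linear drift and jumps only upwards, so ruin from `u ≥
0` occurs by drifting through the level 0, without overshoot. This is why an exact exponential
formula holds rather than an inequality.

Consider a claim paying 1 at ruin, discounted at rate `δ`, and guess its value `exp (-R v)` at
surplus `v`. Conditioning on the first interarrival time and reward, the guess reproduces itself for
every `v ≥ 0` when `R` solves Lundberg's equation (`integral_stepValue`). Hence the discounted value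
at successive arrivals, frozen at ruin, has constant mean `exp (-R u)` (`integral_discountedValue`).
It is bounded by 1 and converges to `exp (-δ τ)` because the arrival times diverge
(`tendsto_discountedValue`), and dominated convergence identifies the two.

The root is unique because `R ↦ r + δ - c R - r E[exp (-R W)]` is concave, equals `δ > 0` at 0 and
is nonpositive at `(r + δ) / c`. On the probabilistic side, independence of `M` and `W` must be
transferred to the interarrival times (`indepFun_interarrival`), which are almost surely functions
of `M`. -/

namespace MinerRuin

open Filter Topology

/-- The time of the `n`-th arrival, given the interarrival times `e`. -/
noncomputable def arrivalTime (e : ℕ → ℝ) (n : ℕ) : ℝ := ∑ k ∈ Finset.range n, e k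

/-- The surplus immediately after the `n`-th arrival. -/
noncomputable def capital (c u : ℝ) (e w : ℕ → ℝ) (n : ℕ) : ℝ :=
  u - c * arrivalTime e n + ∑ k ∈ Finset.range n, w k

/-- The discount factor `exp (-δ S_n)` at the `n`-th arrival, killed once the surplus has become
negative before that arrival. -/
noncomputable def killedDiscount (c u δ : ℝ) (e w : ℕ → ℝ) : ℕ → ℝ
  | 0 => 1
  | n + 1 => if c * e n ≤ capital c u e w n
      then killedDiscount c u δ e w n * Real.exp (-δ * e n) else 0

/-- The candidate ruin time: the infimum of the times at which a negative surplus is reached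
between two consecutive arrivals. -/
noncomputable def ruinTimeOfGaps (c u : ℝ) (e w : ℕ → ℝ) : ℝ≥0∞ :=
  ⨅ n : ℕ, if capital c u e w n < c * e n
    then ENNReal.ofReal (arrivalTime e n + max (capital c u e w n) 0 / c) else ⊤

/-- The probability that an exponential time of rate `δ` is at least `x`. -/
noncomputable def expSurvival (δ : ℝ) (x : ℝ≥0∞) : ℝ :=
  if x = ⊤ then 0 else Real.exp (-δ * x.toReal)

/-- The discounted value at the `n`-th arrival of a claim paying `1` at ruin, if its value is
`exp (-R v)` when the surplus is `v`. -/
noncomputable def discountedValue (c u δ R : ℝ) (e w : ℕ → ℝ) (n : ℕ) : ℝ :=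
  killedDiscount c u δ e w n * Real.exp (-R * capital c u e w n) +
    ∑ k ∈ Finset.range n, if capital c u e w k < c * e k then
      killedDiscount c u δ e w k * Real.exp (-δ * (capital c u e w k / c)) else 0

/-! ### Deterministic analysis of a single path -/

section Paths

variable {c u δ R : ℝ} {e w : ℕ → ℝ}

lemma arrivalTime_succ (n : ℕ) : arrivalTime e (n + 1) = arrivalTime e n + e n :=
  Finset.sum_range_succ _ _

@[simp] lemma arrivalTime_zero : arrivalTime e 0 = 0 := Finset.sum_range_zero _

@[simp] lemma capital_zero : capital c u e w 0 = u := by simp [capital]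

lemma capital_succ (n : ℕ) :
    capital c u e w (n + 1) = capital c u e w n - c * e n + w n := by
  simp only [capital, arrivalTime_succ, Finset.sum_range_succ]; ring

lemma arrivalTime_strictMono (he : ∀ k, 0 < e k) : StrictMono (arrivalTime e) :=
  strictMono_nat_of_lt_succ fun n => by rw [arrivalTime_succ]; linarith [he n]

lemma arrivalTime_nonneg (he : ∀ k, 0 < e k) (n : ℕ) : 0 ≤ arrivalTime e n :=
  Finset.sum_nonneg fun k _ => (he k).le

lemma exists_arrivalTime_le_lt (hS : Tendsto (arrivalTime e) atTop atTop) {s : ℝ} (hs : 0 ≤ s) :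
    ∃ n, arrivalTime e n ≤ s ∧ s < arrivalTime e (n + 1) := by
  have hex : ∃ n, s < arrivalTime e (n + 1) :=
    ((hS.comp (tendsto_add_atTop_nat 1)).eventually_gt_atTop s).exists
  classical
  refine ⟨Nat.find hex, ?_, Nat.find_spec hex⟩
  rcases h : Nat.find hex with _ | m
  · simpa using hs
  · exact not_lt.1 (Nat.find_min hex (m := m) (by omega))

lemma ncard_arrivalTime_le (he : ∀ k, 0 < e k) {s : ℝ} {n : ℕ} (h1 : arrivalTime e n ≤ s)
    (h2 : s < arrivalTime e (n + 1)) : {k : ℕ | arrivalTime e (k + 1) ≤ s}.ncard = n := by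
  have : {k : ℕ | arrivalTime e (k + 1) ≤ s} = (Finset.range n : Set ℕ) := by
    ext k
    simp only [Set.mem_ofPred_eq, Finset.coe_range, Set.mem_Iio]
    constructor
    · intro h
      have := (arrivalTime_strictMono he).lt_iff_lt.1 (h.trans_lt h2)
      omega
    · intro h
      exact ((arrivalTime_strictMono he).monotone (by omega)).trans h1
  rw [this, Set.ncard_coe_finset, Finset.card_range]

/-- Between arrivals the surplus falls at rate `c`, so a gap contains a negative value exactly when
the drift over the whole gap exceeds the capital at its start. This replaces an infimum over
uncountably many times by a countable one, which is visibly measurable. No sign is imposed on `u` or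
`w`, hence the truncation at 0. -/
lemma iInf_surplus_neg_eq (hc : 0 < c) (he : ∀ k, 0 < e k)
    (hS : Tendsto (arrivalTime e) atTop atTop) {m : ℝ≥0 → ℕ}
    (hm : ∀ s : ℝ≥0, m s = {k : ℕ | arrivalTime e (k + 1) ≤ (s : ℝ)}.ncard) :
    (⨅ (s : ℝ≥0) (_ : u - c * (s : ℝ) + ∑ k ∈ Finset.range (m s), w k < 0), (s : ℝ≥0∞)) =
      ruinTimeOfGaps c u e w := by
  have key : ∀ (s : ℝ≥0) (n : ℕ), arrivalTime e n ≤ s → (s : ℝ) < arrivalTime e (n + 1) →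
      u - c * (s : ℝ) + ∑ k ∈ Finset.range (m s), w k =
        capital c u e w n - c * (s - arrivalTime e n) := by
    intro s n h1 h2
    rw [hm s, ncard_arrivalTime_le he h1 h2, capital]; ring
  apply le_antisymm
  · refine le_iInf fun n => ?_
    split_ifs with hn
    -- The candidate time need not itself have negative surplus, so a time `r` is taken strictly
    -- after it, before the next arrival and below the supposed larger infimum.
    · by_contra! hlt
      have hlt2 : ENNReal.ofReal (arrivalTime e n + max (capital c u e w n) 0 / c) <
          ENNReal.ofReal (arrivalTime e (n + 1)) := by
        rw [ENNReal.ofReal_lt_ofReal_iff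
          ((arrivalTime_nonneg he n).trans_lt (arrivalTime_strictMono he (Nat.lt_succ_self n))),
          arrivalTime_succ, add_lt_add_iff_left, div_lt_iff₀ hc]
        exact max_lt (by linarith) (mul_pos (he n) hc)
      obtain ⟨r, hr1, hr2⟩ := ENNReal.lt_iff_exists_nnreal_btwn.1 (lt_min hlt hlt2)
      obtain ⟨hr2, hr3⟩ := lt_min_iff.1 hr2
      refine hr2.not_ge (iInf₂_le r ?_)
      have h1 : arrivalTime e n + max (capital c u e w n) 0 / c < r := by
        rw [← ENNReal.ofReal_coe_nnreal] at hr1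
        exact (ENNReal.ofReal_lt_ofReal_iff_of_nonneg (by
          have := arrivalTime_nonneg he n; positivity)).1 hr1
      have h2 : (r : ℝ) < arrivalTime e (n + 1) := by
        rw [← ENNReal.ofReal_coe_nnreal] at hr3
        exact (ENNReal.ofReal_lt_ofReal_iff_of_nonneg r.2).1 hr3
      have h3 : 0 ≤ max (capital c u e w n) 0 / c := by positivity
      rw [key r n (by linarith) h2]
      have h4 : max (capital c u e w n) 0 / c < r - arrivalTime e n := by linarith
      rw [div_lt_iff₀ hc] at h4
      linarith [le_max_left (capital c u e w n) 0]
    · exact le_top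
  · refine le_iInf₂ fun s hs => ?_
    obtain ⟨n, h1, h2⟩ := exists_arrivalTime_le_lt hS s.coe_nonneg
    rw [key s n h1 h2] at hs
    refine iInf_le_of_le n ?_
    rw [arrivalTime_succ] at h2
    have h3 : c * (s - arrivalTime e n) ≤ c * e n :=
      mul_le_mul_of_nonneg_left (by linarith) hc.le
    rw [if_pos (by linarith), ← ENNReal.ofReal_coe_nnreal]
    apply ENNReal.ofReal_le_ofReal
    have : max (capital c u e w n) 0 / c ≤ s - arrivalTime e n := by
      rw [div_le_iff₀ hc]
      exact max_le (by linarith) (mul_nonneg (by linarith) hc.le)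
    linarith

/-- The one-step identity is available only for nonnegative surplus; a nonzero weight guarantees
this. -/
lemma killedDiscount_eq_zero_or (hu : 0 ≤ u) (hw : ∀ k, 0 < w k) (n : ℕ) :
    killedDiscount c u δ e w n = 0 ∨
      (killedDiscount c u δ e w n = Real.exp (-δ * arrivalTime e n) ∧
        0 ≤ capital c u e w n ∧ ∀ k < n, c * e k ≤ capital c u e w k) := by
  induction n with
  | zero => right; simp [killedDiscount, hu]
  | succ n ih =>
    by_cases h : c * e n ≤ capital c u e w n
    · simp only [killedDiscount, if_pos h]
      rcases ih with ih | ⟨h1, h2, h3⟩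
      · left; rw [ih, zero_mul]
      · right
        refine ⟨?_, ?_, fun k hk => ?_⟩
        · rw [h1, ← Real.exp_add, arrivalTime_succ]; ring_nf
        · rw [capital_succ]; linarith [hw n]
        · rcases Nat.lt_succ_iff_lt_or_eq.1 hk with hk | rfl
          exacts [h3 k hk, h]
    · left; simp [killedDiscount, h]

/-- The increment is a weight fixed by the past times the error of the guess `exp (-R v)` over one
gap, which is what makes the sequence a martingale. -/
lemma discountedValue_succ (n : ℕ) :
    discountedValue c u δ R e w (n + 1) = discountedValue c u δ R e w n +
      killedDiscount c u δ e w n * ((if capital c u e w n < c * e n then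
          Real.exp (-δ * (capital c u e w n / c)) else
          Real.exp (-δ * e n) * Real.exp (-R * (capital c u e w n - c * e n + w n))) -
        Real.exp (-R * capital c u e w n)) := by
  by_cases h : capital c u e w n < c * e n
  · simp only [discountedValue, Finset.sum_range_succ, killedDiscount, h, if_true, not_le.2 h,
      if_false]
    ring
  · simp only [discountedValue, Finset.sum_range_succ, killedDiscount, h, if_true, not_lt.1 h,
      if_false, capital_succ]
    ring

lemma ruinTimeOfGaps_eq_of_first (hc : 0 < c) (he : ∀ k, 0 < e k) {n : ℕ}
    (h : ∀ k < n, c * e k ≤ capital c u e w k) (hn : capital c u e w n < c * e n)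
    (h0 : 0 ≤ capital c u e w n) :
    ruinTimeOfGaps c u e w = ENNReal.ofReal (arrivalTime e n + capital c u e w n / c) := by
  apply le_antisymm
  · refine iInf_le_of_le n ?_
    rw [if_pos hn, max_eq_left h0]
  · refine le_iInf fun k => ?_
    split_ifs with hk
    · rcases lt_trichotomy k n with hkn | rfl | hkn
      · exact absurd (h k hkn) (not_le.2 hk)
      · rw [max_eq_left h0]
      -- A later gap starts after the whole of gap `n`, while the descent to 0 takes less than `e
      -- n`.
      · apply ENNReal.ofReal_le_ofReal
        have h1 : arrivalTime e (n + 1) ≤ arrivalTime e k :=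
          (arrivalTime_strictMono he).monotone hkn
        have h2 : capital c u e w n / c < e n := by rw [div_lt_iff₀ hc]; linarith
        have h3 : 0 ≤ max (capital c u e w k) 0 / c := by positivity
        rw [arrivalTime_succ] at h1
        linarith
    · exact le_top

lemma le_ruinTimeOfGaps (hc : 0 < c) (he : ∀ k, 0 < e k) {n : ℕ}
    (h : ∀ k < n, c * e k ≤ capital c u e w k) :
    ENNReal.ofReal (arrivalTime e n) ≤ ruinTimeOfGaps c u e w := by
  refine le_iInf fun k => ?_
  split_ifs with hk
  · have hkn : n ≤ k := not_lt.1 fun hkn => absurd (h k hkn) (not_le.2 hk)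
    apply ENNReal.ofReal_le_ofReal
    have h1 : arrivalTime e n ≤ arrivalTime e k := (arrivalTime_strictMono he).monotone hkn
    have h3 : 0 ≤ max (capital c u e w k) 0 / c := by positivity
    linarith
  · exact le_top

lemma expSurvival_nonneg (x : ℝ≥0∞) : 0 ≤ expSurvival δ x := by
  unfold expSurvival; split_ifs <;> positivity

lemma expSurvival_ofReal {x : ℝ} (hx : 0 ≤ x) :
    expSurvival δ (ENNReal.ofReal x) = Real.exp (-δ * x) := by
  simp [expSurvival, hx]

lemma expSurvival_antitone (hδ : 0 < δ) : Antitone (expSurvival δ) := by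
  intro x y hxy
  by_cases hy : y = ⊤
  · have : expSurvival δ y = 0 := by simp [expSurvival, hy]
    rw [this]; exact expSurvival_nonneg x
  · have hx : x ≠ ⊤ := ne_top_of_le_ne_top hy hxy
    simp only [expSurvival, hx, hy, if_false]
    have := ENNReal.toReal_mono hy hxy
    exact Real.exp_le_exp.2 (by nlinarith)

/-- Before ruin the sum in the discounted value vanishes; from ruin on, the value is frozen at the
discount factor of the ruin time. -/
lemma discountedValue_eq (hc : 0 < c) (hu : 0 ≤ u) (he : ∀ k, 0 < e k) (hw : ∀ k, 0 < w k)
    (n : ℕ) :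
    ((∀ k < n, c * e k ≤ capital c u e w k) ∧ 0 ≤ capital c u e w n ∧
      killedDiscount c u δ e w n = Real.exp (-δ * arrivalTime e n) ∧
      discountedValue c u δ R e w n =
        Real.exp (-δ * arrivalTime e n) * Real.exp (-R * capital c u e w n)) ∨
    (killedDiscount c u δ e w n = 0 ∧
      discountedValue c u δ R e w n = expSurvival δ (ruinTimeOfGaps c u e w)) := by
  induction n with
  | zero => left; simp [killedDiscount, discountedValue, hu]
  | succ n ih =>
    rcases ih with ⟨h1, h2, h3, h4⟩ | ⟨h1, h2⟩
    · by_cases h : c * e n ≤ capital c u e w n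
      · left
        refine ⟨fun k hk => ?_, ?_, ?_, ?_⟩
        · rcases Nat.lt_succ_iff_lt_or_eq.1 hk with hk | rfl
          exacts [h1 k hk, h]
        · rw [capital_succ]; linarith [hw n]
        · rw [killedDiscount, if_pos h, h3, ← Real.exp_add, arrivalTime_succ]; ring_nf
        · rw [discountedValue_succ, h3, h4, if_neg (not_lt.2 h), capital_succ, arrivalTime_succ,
            mul_add (-δ), Real.exp_add]
          ring
      · right
        refine ⟨by rw [killedDiscount, if_neg h], ?_⟩
        rw [ruinTimeOfGaps_eq_of_first hc he h1 (not_le.1 h) h2, expSurvival_ofReal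
          (by have := arrivalTime_nonneg he n; positivity), discountedValue_succ, h3, h4,
          if_pos (not_le.1 h), mul_add (-δ), Real.exp_add]
        ring
    · right
      refine ⟨by simp [killedDiscount, h1], ?_⟩
      rw [discountedValue_succ, h1, h2]; ring

/-- If the first `n` gaps are survived, both terms lie between 0 and `exp (-δ S_n)`, since ruin
comes no earlier than `S_n`; otherwise they coincide. -/
lemma abs_discountedValue_sub_le (hc : 0 < c) (hδ : 0 < δ) (hR : 0 < R) (hu : 0 ≤ u)
    (he : ∀ k, 0 < e k) (hw : ∀ k, 0 < w k) (n : ℕ) :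
    |discountedValue c u δ R e w n - expSurvival δ (ruinTimeOfGaps c u e w)| ≤
      Real.exp (-δ * arrivalTime e n) := by
  rcases discountedValue_eq (δ := δ) (R := R) hc hu he hw n with ⟨h1, h2, -, h4⟩ | ⟨-, h2⟩
  · have h5 := expSurvival_antitone hδ (le_ruinTimeOfGaps hc he h1)
    rw [expSurvival_ofReal (arrivalTime_nonneg he n)] at h5
    have h6 : Real.exp (-R * capital c u e w n) ≤ 1 := Real.exp_le_one_iff.2 (by nlinarith)
    rw [h4, abs_le]
    have h7 := expSurvival_nonneg (δ := δ) (ruinTimeOfGaps c u e w)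
    have h8 := Real.exp_pos (-δ * arrivalTime e n)
    have h9 := Real.exp_pos (-R * capital c u e w n)
    constructor <;> nlinarith [mul_pos h8 h9]
  · rw [h2, sub_self, abs_zero]; positivity

lemma abs_discountedValue_le (hc : 0 < c) (hδ : 0 < δ) (hR : 0 < R) (hu : 0 ≤ u)
    (he : ∀ k, 0 < e k) (hw : ∀ k, 0 < w k) (n : ℕ) :
    |discountedValue c u δ R e w n| ≤ 1 := by
  have hle : ∀ x : ℝ≥0∞, |expSurvival δ x| ≤ 1 := fun x => by
    rw [abs_of_nonneg (expSurvival_nonneg x)]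
    simpa [expSurvival] using expSurvival_antitone hδ (zero_le : (0 : ℝ≥0∞) ≤ x)
  rcases discountedValue_eq (δ := δ) (R := R) hc hu he hw n with ⟨-, h2, -, h4⟩ | ⟨-, h2⟩
  · rw [h4, ← Real.exp_add, abs_of_pos (Real.exp_pos _)]
    exact Real.exp_le_one_iff.2 (by have := arrivalTime_nonneg he n; nlinarith)
  · rw [h2]; exact hle _

lemma tendsto_discountedValue (hc : 0 < c) (hδ : 0 < δ) (hR : 0 < R) (hu : 0 ≤ u)
    (he : ∀ k, 0 < e k) (hw : ∀ k, 0 < w k) (hS : Tendsto (arrivalTime e) atTop atTop) :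
    Tendsto (discountedValue c u δ R e w) atTop
      (𝓝 (expSurvival δ (ruinTimeOfGaps c u e w))) := by
  rw [tendsto_iff_dist_tendsto_zero]
  refine squeeze_zero (fun _ => dist_nonneg)
    (fun n => abs_discountedValue_sub_le hc hδ hR hu he hw n) ?_
  refine Real.tendsto_exp_atBot.comp ?_
  simp only [neg_mul]
  exact tendsto_neg_atTop_atBot.comp (hS.const_mul_atTop hδ)

end Paths

/-! ### Lundberg's equation -/

/-- Lundberg's equation with a positive killing rate `δ` has exactly one positive root. -/
lemma existsUnique_lundberg_root {ν : Measure ℝ} [IsProbabilityMeasure ν]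
    (hν : ∀ᵐ w ∂ν, 0 < w) {r δ c : ℝ} (hr : 0 < r) (hδ : 0 < δ) (hc : 0 < c) :
    ∃! R : ℝ, 0 < R ∧ r + δ - c * R = r * ∫ w, Real.exp (-R * w) ∂ν := by
  have hbound : ∀ R : ℝ, 0 ≤ R → ∀ᵐ w ∂ν, ‖Real.exp (-R * w)‖ ≤ 1 := fun R hR => by
    filter_upwards [hν] with w hw
    rw [Real.norm_eq_abs, Real.abs_exp]
    exact Real.exp_le_one_iff.2 (by nlinarith)
  have hint : ∀ R : ℝ, 0 ≤ R → Integrable (fun w => Real.exp (-R * w)) ν := fun R hR =>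
    Integrable.of_bound (by fun_prop) 1 (hbound R hR)
  have hcont : ContinuousOn
      (fun R => r + δ - c * R - r * ∫ w, Real.exp (-R * w) ∂ν) (Set.Ici 0) := by
    have : ContinuousOn (fun R => ∫ w, Real.exp (-R * w) ∂ν) (Set.Ici 0) :=
      continuousOn_of_dominated (bound := fun _ => 1)
        (fun R _ => (by fun_prop)) (fun R hR => hbound R hR) (integrable_const _)
        (Eventually.of_forall fun w => by fun_prop)
    fun_prop
  have h0 : r + δ - c * 0 - r * ∫ w, Real.exp (-0 * w) ∂ν = δ := by simp
  have hpos : 0 < (r + δ) / c := by positivity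
  have h1 : r + δ - c * ((r + δ) / c) - r * ∫ w, Real.exp (-((r + δ) / c) * w) ∂ν ≤ 0 := by
    have : 0 ≤ ∫ w, Real.exp (-((r + δ) / c) * w) ∂ν :=
      integral_nonneg fun w => (Real.exp_pos _).le
    rw [mul_div_cancel₀ _ hc.ne']
    nlinarith
  obtain ⟨R, ⟨hR0, -⟩, hR⟩ := intermediate_value_Icc' hpos.le (hcont.mono Set.Icc_subset_Ici_self)
    (show (0 : ℝ) ∈ Set.Icc _ _ from ⟨h1, by rw [h0]; exact hδ.le⟩)
  have hRpos : 0 < R := by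
    rcases hR0.eq_or_lt with rfl | h
    · simp only [h0] at hR; exact absurd hR hδ.ne'
    · exact h
  have huniq : ∀ R₁ R₂ : ℝ, 0 < R₁ → R₁ < R₂ →
      r + δ - c * R₁ = r * ∫ w, Real.exp (-R₁ * w) ∂ν →
      r + δ - c * R₂ = r * ∫ w, Real.exp (-R₂ * w) ∂ν → False := by
    intro R₁ R₂ hR₁ hlt e₁ e₂
    have hR₂ : 0 < R₂ := hR₁.trans hlt
    set θ := R₁ / R₂
    have hθ0 : 0 < θ := by positivity
    have hθ1 : θ < 1 := (div_lt_one hR₂).2 hlt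
    have hθ : θ * R₂ = R₁ := div_mul_cancel₀ _ hR₂.ne'
    -- Convexity of `exp` between `0` and `-R₂ * w`, with weight `θ = R₁ / R₂`. Inserting both root
    -- equations leaves `δ ≤ θ * δ`, which is absurd for `θ < 1`.
    have hle : ∫ w, Real.exp (-R₁ * w) ∂ν ≤ ∫ w, ((1 - θ) + θ * Real.exp (-R₂ * w)) ∂ν := by
      refine integral_mono (hint _ hR₁.le)
        ((integrable_const _).add ((hint _ hR₂.le).const_mul _)) fun w => ?_
      have := convexOn_exp.2 (Set.mem_univ 0) (Set.mem_univ (-R₂ * w)) (sub_nonneg.2 hθ1.le)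
        hθ0.le (by ring)
      simp only [smul_eq_mul, mul_zero, zero_add, Real.exp_zero, mul_one] at this
      rwa [show θ * (-R₂ * w) = -R₁ * w by rw [← hθ]; ring] at this
    rw [integral_add (integrable_const _) ((hint _ hR₂.le).const_mul _), integral_const_mul,
      integral_const, probReal_univ, one_smul] at hle
    have h2 := mul_le_mul_of_nonneg_left hle hr.le
    rw [← e₁, mul_add, mul_left_comm, ← e₂, ← hθ] at h2
    nlinarith
  refine ⟨R, ⟨hRpos, by linarith⟩, fun R' ⟨hR', e'⟩ => ?_⟩
  rcases lt_trichotomy R' R with h | h | h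
  · exact (huniq R' R hR' h e' (by linarith)).elim
  · exact h
  · exact (huniq R R' hRpos h (by linarith) e').elim

/-! ### The exponential distribution -/

section ExponentialLaw

variable {r : ℝ}

lemma integral_expMeasure (hr : 0 < r) (f : ℝ → ℝ) :
    ∫ x, f x ∂expMeasure r = ∫ x in Set.Ioi 0, r * Real.exp (-r * x) * f x := by
  have hm : Measurable (gammaPDF 1 r) := (measurable_gammaPDFReal 1 r).ennreal_ofReal
  rw [expMeasure, gammaMeasure, integral_withDensity_eq_integral_toReal_smul
    hm (by simp [gammaPDF]),
    ← integral_Ici_eq_integral_Ioi, ← integral_indicator measurableSet_Ici]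
  congr 1 with x
  have h : gammaPDF 1 r x = exponentialPDF r x := rfl
  rw [h, exponentialPDF_eq]
  by_cases hx : 0 ≤ x
  · simp [hx, Set.indicator, ENNReal.toReal_ofReal (mul_pos hr (Real.exp_pos _)).le]
  · simp [hx, Set.indicator]

lemma expMeasure_real_Iic (hr : 0 < r) (x : ℝ) :
    (expMeasure r).real (Set.Iic x) = if 0 ≤ x then 1 - Real.exp (-(r * x)) else 0 := by
  have := isProbabilityMeasure_expMeasure hr
  rw [← cdf_eq_real, cdf_expMeasure_eq hr]

lemma expMeasure_real_Ioi (hr : 0 < r) {x : ℝ} (hx : 0 ≤ x) :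
    (expMeasure r).real (Set.Ioi x) = Real.exp (-r * x) := by
  have := isProbabilityMeasure_expMeasure hr
  rw [← Set.compl_Iic, probReal_compl_eq_one_sub measurableSet_Iic, expMeasure_real_Iic hr,
    if_pos hx]
  simp

lemma ae_expMeasure_pos (hr : 0 < r) : ∀ᵐ x ∂expMeasure r, 0 < x := by
  have := isProbabilityMeasure_expMeasure hr
  have h := expMeasure_real_Iic hr 0
  simp only [le_refl, if_true, mul_zero, neg_zero, Real.exp_zero, sub_self] at h
  rw [measureReal_eq_zero_iff] at h
  rw [ae_iff]
  simpa [Set.Iic] using h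

lemma expMeasure_real_le_ofReal (hr : 0 < r) (x : ℝ≥0∞) :
    (expMeasure r).real {s | x ≤ ENNReal.ofReal s} = expSurvival r x := by
  have hP := isProbabilityMeasure_expMeasure hr
  by_cases hx : x = ⊤
  · simp [hx, expSurvival]
  · rw [expSurvival, if_neg hx, ← expMeasure_real_Ioi hr ENNReal.toReal_nonneg]
    have hna : NullSingletonClass (expMeasure r) :=
      ⟨fun x => withDensity_absolutelyContinuous _ _ (measure_singleton x)⟩
    -- `ENNReal.ofReal` sends negative `s` to 0, so for `x = 0` the two sets agree only up to a null
    -- set.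
    have : {s | x ≤ ENNReal.ofReal s} =ᵐ[expMeasure r] Set.Ici x.toReal := by
      filter_upwards [ae_expMeasure_pos hr] with s hs
      refine propext ?_
      exact ENNReal.le_ofReal_iff_toReal_le hx hs.le
    rw [measureReal_congr this, measureReal_congr Ioi_ae_eq_Ici]

end ExponentialLaw

/-! ### The one-step renewal identity -/

/-- The value of the claim paying `1` at ruin, discounted to the start of an interarrival interval
with initial surplus `v`, length `y.1` and final reward `y.2`. -/
noncomputable def stepValue (c δ R v : ℝ) (y : ℝ × ℝ) : ℝ :=
  if v < c * y.1 then Real.exp (-δ * (v / c)) else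
    Real.exp (-δ * y.1) * Real.exp (-R * (v - c * y.1 + y.2))

section OneStep

variable {r δ c R v : ℝ} {ν : Measure ℝ} [IsProbabilityMeasure ν]

@[fun_prop]
lemma measurable_stepValue_uncurry :
    Measurable fun x : ℝ × (ℝ × ℝ) => stepValue c δ R x.1 x.2 := by
  unfold stepValue
  refine Measurable.ite (measurableSet_lt ?_ ?_) ?_ ?_ <;> fun_prop

lemma stepValue_nonneg (y : ℝ × ℝ) : 0 ≤ stepValue c δ R v y := by
  unfold stepValue; split_ifs <;> positivity

lemma stepValue_le_one (hc : 0 < c) (hδ : 0 < δ) (hR : 0 < R) (hv : 0 ≤ v) {y : ℝ × ℝ}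
    (h1 : 0 < y.1) (h2 : 0 < y.2) : stepValue c δ R v y ≤ 1 := by
  unfold stepValue
  split_ifs with h
  · have : 0 ≤ v / c := by positivity
    exact Real.exp_le_one_iff.2 (by nlinarith)
  · rw [← Real.exp_add]
    have h3 : 0 ≤ v - c * y.1 + y.2 := by linarith
    exact Real.exp_le_one_iff.2 (by nlinarith [mul_nonneg hR.le h3, mul_pos hδ h1])

lemma integrable_stepValue (hr : 0 < r) (hc : 0 < c) (hδ : 0 < δ) (hR : 0 < R) (hv : 0 ≤ v)
    (hν : ∀ᵐ w ∂ν, 0 < w) : Integrable (stepValue c δ R v) ((expMeasure r).prod ν) := by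
  have := isProbabilityMeasure_expMeasure hr
  have hm : Measurable (stepValue c δ R v) :=
    measurable_stepValue_uncurry.comp measurable_prodMk_left
  refine Integrable.of_bound hm.aestronglyMeasurable 1 ?_
  have h1 := Measure.quasiMeasurePreserving_fst (μ := expMeasure r) (ν := ν)
    |>.ae (ae_expMeasure_pos hr)
  have h2 := Measure.quasiMeasurePreserving_snd (μ := expMeasure r) (ν := ν) |>.ae hν
  filter_upwards [h1, h2] with y h1 h2
  rw [Real.norm_eq_abs, abs_of_nonneg (stepValue_nonneg y)]
  exact stepValue_le_one hc hδ hR hv h1 h2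

/-- With `κ = r + δ - c R = r E[exp (-R W)]`, the gaps shorter than `a = v / c` contribute `exp (-R
v)` times the mass of an exponential law of rate `κ` on `(0, a]`. The missing tail `exp (-R v - κ
a)` is exactly the ruin contribution `exp (-(δ + r) a)`, because `v = c a`. -/
lemma integral_stepValue (hr : 0 < r) (hc : 0 < c) (hδ : 0 < δ) (hR : 0 < R) (hv : 0 ≤ v)
    (hν : ∀ᵐ w ∂ν, 0 < w) (hroot : r + δ - c * R = r * ∫ w, Real.exp (-R * w) ∂ν) :
    ∫ y, stepValue c δ R v y ∂((expMeasure r).prod ν) = Real.exp (-R * v) := by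
  have := isProbabilityMeasure_expMeasure hr
  rw [integral_prod _ (integrable_stepValue hr hc hδ hR hv hν)]
  set L := ∫ w, Real.exp (-R * w) ∂ν with hL
  have hint : Integrable (fun w => Real.exp (-R * w)) ν := by
    refine Integrable.of_bound (by fun_prop) 1 ?_
    filter_upwards [hν] with w hw
    rw [Real.norm_eq_abs, Real.abs_exp]
    exact Real.exp_le_one_iff.2 (by nlinarith)
  have hLpos : 0 < L := integral_exp_pos hint
  set κ := r + δ - c * R with hκ
  have hκpos : 0 < κ := by rw [hroot]; positivity
  have hinner : ∀ e : ℝ, ∫ w, stepValue c δ R v (e, w) ∂ν =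
      if v < c * e then Real.exp (-δ * (v / c))
      else Real.exp (-R * v) * L * Real.exp (-(κ - r) * e) := by
    intro e
    unfold stepValue
    split_ifs with h
    · simp
    · have : ∀ w, Real.exp (-δ * e) * Real.exp (-R * (v - c * e + w)) =
          Real.exp (-R * v) * Real.exp (-(κ - r) * e) * Real.exp (-R * w) := fun w => by
        simp only [← Real.exp_add, hκ]; ring_nf
      simp only [this]
      rw [integral_const_mul]; ring
  simp only [hinner]
  rw [integral_expMeasure hr]
  set a := v / c with ha
  have ha0 : 0 ≤ a := by positivity
  have hlt : ∀ e, v < c * e ↔ a < e := fun e => by rw [ha, div_lt_iff₀' hc]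
  have hIoc : Set.EqOn (fun e => r * Real.exp (-r * e) * (if v < c * e then Real.exp (-δ * a)
      else Real.exp (-R * v) * L * Real.exp (-(κ - r) * e)))
      (fun e => Real.exp (-R * v) * (κ * Real.exp (-(κ * e)))) (Set.Ioc 0 a) := by
    intro e he
    simp only [hlt, not_lt.2 he.2, if_false]
    rw [show -(κ * e) = -r * e + -(κ - r) * e by ring, Real.exp_add]
    linear_combination (-(Real.exp (-R * v) * Real.exp (-r * e) * Real.exp (-(κ - r) * e))) * hroot
  have hIoi : Set.EqOn (fun e => r * Real.exp (-r * e) * (if v < c * e then Real.exp (-δ * a)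
      else Real.exp (-R * v) * L * Real.exp (-(κ - r) * e)))
      (fun e => Real.exp (-δ * a) * r * Real.exp (-r * e)) (Set.Ioi a) := by
    intro e he
    simp only [hlt, Set.mem_Ioi.1 he, if_true]; ring
  have hI1 : IntegrableOn (fun e => Real.exp (-R * v) * (κ * Real.exp (-(κ * e))))
      (Set.Ioc 0 a) :=
    (by fun_prop : Continuous fun e => Real.exp (-R * v) * (κ * Real.exp (-(κ * e))))
      |>.integrableOn_Ioc
  have hI2 : IntegrableOn (fun e => Real.exp (-δ * a) * r * Real.exp (-r * e)) (Set.Ioi a) :=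
    (integrableOn_exp_mul_Ioi (neg_lt_zero.2 hr) a).const_mul _
  rw [← Set.Ioc_union_Ioi_eq_Ioi ha0, setIntegral_union Set.Ioc_disjoint_Ioi_same measurableSet_Ioi
    (hI1.congr_fun hIoc.symm measurableSet_Ioc) (hI2.congr_fun hIoi.symm measurableSet_Ioi),
    setIntegral_congr_fun measurableSet_Ioc hIoc, setIntegral_congr_fun measurableSet_Ioi hIoi,
    integral_const_mul (Real.exp (-R * v)), integral_const_mul (Real.exp (-δ * a) * r),
    integral_exp_mul_Ioi (neg_lt_zero.2 hr),
    ← intervalIntegral.integral_of_le ha0,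
    intervalIntegral.integral_eq_sub_of_hasDerivAt (fun x _ => hasDerivAt_neg_exp_mul_exp)
      ((by fun_prop : Continuous fun e => κ * Real.exp (-(κ * e))).intervalIntegrable _ _)]
  have h1 : Real.exp (-R * v) * Real.exp (-(κ * a)) = Real.exp (-δ * a) * Real.exp (-r * a) := by
    rw [← Real.exp_add, ← Real.exp_add, hκ]
    congr 1
    have : v = c * a := by rw [ha]; field_simp
    rw [this]; ring
  simp only [mul_zero, neg_zero, Real.exp_zero]
  have h2 : r * (-Real.exp (-r * a) / -r) = Real.exp (-r * a) := by
    rw [neg_div_neg_eq, mul_div_cancel₀ _ hr.ne']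
  linear_combination Real.exp (-δ * a) * h2 - h1

end OneStep

/-! ### Independence of the pairs of gaps and rewards -/

section Independence

variable {Ω : Type*} [MeasurableSpace Ω] {P : Measure Ω}

/-- Rectangles form a generating π-system, and a finite intersection of rectangle events splits into
an event of the first sequence and one of the second. -/
lemma iIndepFun_prodMk_of_indepFun {E W : ℕ → Ω → ℝ} (hE : ∀ k, Measurable (E k))
    (hW : ∀ k, Measurable (W k)) (hEi : iIndepFun E P) (hWi : iIndepFun W P)
    (hEW : IndepFun (fun ω k => E k ω) (fun ω k => W k ω) P) :
    iIndepFun (fun k ω => (E k ω, W k ω)) P := by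
  refine iIndepSets.iIndep (fun k => ((hE k).prodMk (hW k)).comap_le)
    (fun k => Set.image (Set.preimage fun ω => (E k ω, W k ω)) <|
      Set.image2 (· ×ˢ ·) {s : Set ℝ | MeasurableSet s} {t : Set ℝ | MeasurableSet t})
    (fun k => isPiSystem_prod.comap _) (fun k => ?_) ?_
  · rw [← generateFrom_prod, MeasurableSpace.comap_generateFrom]
  · rw [iIndepSets_iff]
    intro S f hf
    have : ∀ k, ∃ A B : Set ℝ, MeasurableSet A ∧ MeasurableSet B ∧
        (k ∈ S → f k = E k ⁻¹' A ∩ W k ⁻¹' B) := by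
      intro k
      by_cases hk : k ∈ S
      · obtain ⟨_, ⟨A, hA, B, hB, rfl⟩, h⟩ := hf k hk
        exact ⟨A, B, hA, hB, fun _ => h.symm⟩
      · exact ⟨∅, ∅, .empty, .empty, fun h => absurd h hk⟩
    choose A B hA hB hAB using this
    have h1 : (⋂ k ∈ S, f k) = (fun ω k => E k ω) ⁻¹' (⋂ k ∈ S, Function.eval k ⁻¹' A k) ∩
        (fun ω k => W k ω) ⁻¹' (⋂ k ∈ S, Function.eval k ⁻¹' B k) := by
      ext ω
      simp only [Set.mem_iInter, Set.mem_inter_iff, Set.mem_preimage, Function.eval]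
      constructor
      · exact fun h => ⟨fun k hk => by have := h k hk; rw [hAB k hk] at this; exact this.1,
          fun k hk => by have := h k hk; rw [hAB k hk] at this; exact this.2⟩
      · intro h k hk
        rw [hAB k hk]
        exact ⟨h.1 k hk, h.2 k hk⟩
    rw [h1, hEW.measure_inter_preimage_eq_mul _ _
      (S.measurableSet_biInter fun k _ => measurable_pi_apply k (hA k))
      (S.measurableSet_biInter fun k _ => measurable_pi_apply k (hB k))]
    have h2 := hEi.measure_inter_preimage_eq_mul S (sets := A) fun k _ => hA k
    have h3 := hWi.measure_inter_preimage_eq_mul S (sets := B) fun k _ => hB k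
    simp only [Set.preimage_iInter, Set.preimage_preimage, Function.eval] at *
    rw [h2, h3, ← Finset.prod_mul_distrib]
    refine Finset.prod_congr rfl fun k hk => ?_
    have hk2 : IndepFun (E k) (W k) P :=
      hEW.comp (measurable_pi_apply k) (measurable_pi_apply k)
    rw [hAB k hk, hk2.measure_inter_preimage_eq_mul _ _ (hA k) (hB k)]

end Independence

/-! ### Measurability of the path functionals -/

section Measurability

variable {Ω : Type*} {m : MeasurableSpace Ω} {E W : ℕ → Ω → ℝ} {c u δ R : ℝ}

/-- The σ-algebra `m` is arbitrary and only indices below `n` are constrained, so that here and in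
the next two lemmas `m` may be the one generated by the past. -/
lemma measurable_arrivalTime {n : ℕ} (hE : ∀ k < n, Measurable (E k)) :
    Measurable fun ω => arrivalTime (fun k => E k ω) n :=
  Finset.measurable_fun_sum _ fun k hk => hE k (Finset.mem_range.1 hk)

lemma measurable_capital {n : ℕ} (hE : ∀ k < n, Measurable (E k))
    (hW : ∀ k < n, Measurable (W k)) :
    Measurable fun ω => capital c u (fun k => E k ω) (fun k => W k ω) n := by
  have h1 := measurable_arrivalTime hE
  have h2 : Measurable fun ω => ∑ k ∈ Finset.range n, W k ω :=
    Finset.measurable_fun_sum _ fun k hk => hW k (Finset.mem_range.1 hk)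
  unfold capital
  fun_prop

lemma measurable_killedDiscount {n : ℕ} (hE : ∀ k < n, Measurable (E k))
    (hW : ∀ k < n, Measurable (W k)) :
    Measurable fun ω => killedDiscount c u δ (fun k => E k ω) (fun k => W k ω) n := by
  induction n with
  | zero => exact measurable_const
  | succ n ih =>
    have h1 := ih (fun k hk => hE k (by omega)) (fun k hk => hW k (by omega))
    have h2 := measurable_capital (c := c) (u := u) (n := n)
      (fun k hk => hE k (by omega)) (fun k hk => hW k (by omega))
    have h3 := hE n (by omega)
    simp only [killedDiscount]
    exact Measurable.ite (measurableSet_le (h3.const_mul c) h2) (by fun_prop) measurable_const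

lemma measurable_discountedValue (hE : ∀ k, Measurable (E k)) (hW : ∀ k, Measurable (W k))
    (n : ℕ) :
    Measurable fun ω => discountedValue c u δ R (fun k => E k ω) (fun k => W k ω) n := by
  have h1 := fun n => measurable_killedDiscount (c := c) (u := u) (δ := δ) (n := n)
    (fun k _ => hE k) (fun k _ => hW k)
  have h2 := fun n => measurable_capital (c := c) (u := u) (n := n)
    (fun k _ => hE k) (fun k _ => hW k)
  unfold discountedValue
  refine ((h1 n).mul ((h2 n).const_mul _).exp).add (Finset.measurable_fun_sum _ fun k _ => ?_)
  exact Measurable.ite (measurableSet_lt (h2 k) ((hE k).const_mul c))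
    ((h1 k).mul (((h2 k).div_const c).const_mul _).exp) measurable_const

lemma measurable_ruinTimeOfGaps (hE : ∀ k, Measurable (E k)) (hW : ∀ k, Measurable (W k)) :
    Measurable fun ω => ruinTimeOfGaps c u (fun k => E k ω) (fun k => W k ω) := by
  unfold ruinTimeOfGaps
  refine Measurable.iInf fun n => ?_
  have h1 := measurable_arrivalTime (n := n) fun k _ => hE k
  have h2 := measurable_capital (c := c) (u := u) (n := n) (fun k _ => hE k) (fun k _ => hW k)
  exact Measurable.ite (measurableSet_lt h2 ((hE n).const_mul c)) (by fun_prop) measurable_const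

end Measurability

/-! ### The martingale argument and the exponential horizon -/

section Renewal

variable {Ω : Type*} [MeasurableSpace Ω] {P : Measure Ω}
  {E W : ℕ → Ω → ℝ} {r c u δ R : ℝ}

lemma indepFun_killedDiscount_capital (hE : ∀ k, Measurable (E k)) (hW : ∀ k, Measurable (W k))
    (hEW : iIndepFun (fun k ω => (E k ω, W k ω)) P) (n : ℕ) :
    IndepFun (fun ω => (killedDiscount c u δ (fun k => E k ω) (fun k => W k ω) n,
      capital c u (fun k => E k ω) (fun k => W k ω) n)) (fun ω => (E n ω, W n ω)) P := by
  have h := indep_iSup_of_disjoint (fun k => ((hE k).prodMk (hW k)).comap_le) hEW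
    (S := Set.Iio n) (T := {n}) (by simp)
  have hle : ∀ k < n, MeasurableSpace.comap (fun ω => (E k ω, W k ω)) inferInstance ≤
      ⨆ i ∈ Set.Iio n, MeasurableSpace.comap (fun ω => (E i ω, W i ω)) inferInstance :=
    fun k hk => le_iSup₂_of_le k hk le_rfl
  have hpast : ∀ k < n, Measurable[⨆ i ∈ Set.Iio n,
      MeasurableSpace.comap (fun ω => (E i ω, W i ω)) inferInstance] fun ω => (E k ω, W k ω) :=
    fun k hk => (comap_measurable _).mono (hle k hk) le_rfl
  have hEp := fun k hk => measurable_fst.comp (hpast k hk)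
  have hWp := fun k hk => measurable_snd.comp (hpast k hk)
  refine indep_of_indep_of_le_left (indep_of_indep_of_le_right h ?_) ?_
  · exact le_iSup₂_of_le n rfl le_rfl
  · exact ((measurable_killedDiscount hEp hWp).prodMk (measurable_capital hEp hWp)).comap_le

/-- By independence the increment integrates against a product law. For a fixed past, the inner
integral over the next gap and reward vanishes by `integral_stepValue`. -/
lemma integral_discountedValue [IsProbabilityMeasure P] (hr : 0 < r) (hc : 0 < c) (hδ : 0 < δ)
    (hR : 0 < R) (hu : 0 ≤ u) (hE : ∀ k, Measurable (E k)) (hW : ∀ k, Measurable (W k))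
    (hEW : iIndepFun (fun k ω => (E k ω, W k ω)) P)
    (hEWk : ∀ k, IndepFun (E k) (W k) P)
    (hElaw : ∀ k, P.map (E k) = expMeasure r) (hWlaw : ∀ k, P.map (W k) = P.map (W 0))
    (hEpos : ∀ᵐ ω ∂P, ∀ k, 0 < E k ω) (hWpos : ∀ᵐ ω ∂P, ∀ k, 0 < W k ω)
    (hroot : r + δ - c * R = r * ∫ ω, Real.exp (-R * W 0 ω) ∂P) (n : ℕ) :
    ∫ ω, discountedValue c u δ R (fun k => E k ω) (fun k => W k ω) n ∂P = Real.exp (-R * u) := by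
  have hZm := measurable_discountedValue (c := c) (u := u) (δ := δ) (R := R) hE hW
  have hZi : ∀ n, Integrable
      (fun ω => discountedValue c u δ R (fun k => E k ω) (fun k => W k ω) n) P := fun n => by
    refine Integrable.of_bound (hZm n).aestronglyMeasurable 1 ?_
    filter_upwards [hEpos, hWpos] with ω h1 h2
    exact abs_discountedValue_le hc hδ hR hu h1 h2 n
  induction n with
  | zero => simp [discountedValue, killedDiscount]
  | succ n ih =>
    rw [← ih, ← sub_eq_zero, ← integral_sub (hZi _) (hZi _)]
    set ν := P.map (W 0) with hν
    have hνP : IsProbabilityMeasure ν := Measure.isProbabilityMeasure_map (hW 0).aemeasurable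
    have hEP := isProbabilityMeasure_expMeasure hr
    have hνpos : ∀ᵐ w ∂ν, 0 < w := by
      rw [hν, ae_map_iff (hW 0).aemeasurable measurableSet_Ioi]
      filter_upwards [hWpos] with ω h using h 0
    have hroot' : r + δ - c * R = r * ∫ w, Real.exp (-R * w) ∂ν := by
      rw [hν, integral_map (hW 0).aemeasurable (by fun_prop), hroot]
    let V : Ω → ℝ × ℝ := fun ω => (killedDiscount c u δ (fun k => E k ω) (fun k => W k ω) n,
      capital c u (fun k => E k ω) (fun k => W k ω) n)
    let Y : Ω → ℝ × ℝ := fun ω => (E n ω, W n ω)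
    have hV : Measurable V := (measurable_killedDiscount (fun k _ => hE k) (fun k _ => hW k)).prodMk
      (measurable_capital (fun k _ => hE k) (fun k _ => hW k))
    have hY : Measurable Y := (hE n).prodMk (hW n)
    have hVY : P.map (fun ω => (V ω, Y ω)) = (P.map V).prod (P.map Y) :=
      (indepFun_iff_map_prod_eq_prod_map_map hV.aemeasurable hY.aemeasurable).1
        (indepFun_killedDiscount_capital hE hW hEW n)
    have hYlaw : P.map Y = (expMeasure r).prod ν := by
      rw [← hElaw n, ← hWlaw n]
      exact (indepFun_iff_map_prod_eq_prod_map_map (hE n).aemeasurable (hW n).aemeasurable).1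
        (hEWk n)
    let f : (ℝ × ℝ) × (ℝ × ℝ) → ℝ := fun x =>
      x.1.1 * (stepValue c δ R x.1.2 x.2 - Real.exp (-R * x.1.2))
    have hf : Measurable f := by
      have h : Measurable fun x : (ℝ × ℝ) × (ℝ × ℝ) => stepValue c δ R x.1.2 x.2 :=
        measurable_stepValue_uncurry.comp
          ((measurable_snd.comp measurable_fst).prodMk measurable_snd)
      fun_prop
    have hfZ : (fun ω => discountedValue c u δ R (fun k => E k ω) (fun k => W k ω) (n + 1) -
        discountedValue c u δ R (fun k => E k ω) (fun k => W k ω) n) = fun ω => f (V ω, Y ω) := by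
      ext ω
      rw [discountedValue_succ, add_sub_cancel_left]
      rfl
    have hfi : Integrable f ((P.map V).prod (P.map Y)) := by
      rw [← hVY, integrable_map_measure hf.aestronglyMeasurable (hV.prodMk hY).aemeasurable]
      exact (congrArg (Integrable · P) hfZ).mp ((hZi _).sub (hZi _))
    rw [hfZ, ← integral_map (hV.prodMk hY).aemeasurable hf.aestronglyMeasurable, hVY,
      integral_prod _ hfi]
    refine integral_eq_zero_of_ae ?_
    -- The one-step identity may fail at negative surplus, but there the weight is 0.
    have hVae : ∀ᵐ x ∂P.map V, x.1 = 0 ∨ 0 ≤ x.2 := by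
      have hset : MeasurableSet {x : ℝ × ℝ | x.1 = 0 ∨ 0 ≤ x.2} :=
        (measurableSet_eq_fun measurable_fst measurable_const).union
          (measurableSet_le measurable_const measurable_snd)
      rw [ae_map_iff hV.aemeasurable hset]
      filter_upwards [hEpos, hWpos] with ω h1 h2
      exact (killedDiscount_eq_zero_or hu h2 n).imp id fun h => h.2.1
    filter_upwards [hVae] with x hx
    rcases hx with hx | hx
    · simp [f, hx]
    · simp only [f, Pi.zero_apply]
      rw [integral_const_mul, hYlaw, integral_sub (integrable_stepValue hr hc hδ hR hx hνpos)
        (integrable_const _), integral_stepValue hr hc hδ hR hx hνpos hroot']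
      simp

lemma ae_interarrival_pos (hr : 0 < r) (hE : ∀ k, Measurable (E k))
    (hElaw : ∀ k, P.map (E k) = expMeasure r) : ∀ᵐ ω ∂P, ∀ k, 0 < E k ω := by
  rw [ae_all_iff]
  intro k
  have := ae_expMeasure_pos hr
  rw [← hElaw k, ae_map_iff (hE k).aemeasurable measurableSet_Ioi] at this
  exact this

/-- By the second Borel–Cantelli lemma infinitely many gaps exceed 1, so their series cannot
converge. -/
lemma ae_tendsto_arrivalTime [IsProbabilityMeasure P] (hr : 0 < r)
    (hE : ∀ k, Measurable (E k)) (hEi : iIndepFun E P)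
    (hElaw : ∀ k, P.map (E k) = expMeasure r) :
    ∀ᵐ ω ∂P, Tendsto (arrivalTime fun k => E k ω) atTop atTop := by
  have hEP := isProbabilityMeasure_expMeasure hr
  have hs : ∀ k, MeasurableSet (E k ⁻¹' Set.Ioi 1) := fun k => hE k measurableSet_Ioi
  have hind : iIndepSet (fun k => E k ⁻¹' Set.Ioi 1) P := by
    rw [iIndepSet_iff_meas_biInter hs]
    exact fun S => hEi.measure_inter_preimage_eq_mul S fun _ _ => measurableSet_Ioi
  have hconst : ∀ k, P (E k ⁻¹' Set.Ioi 1) = expMeasure r (Set.Ioi 1) := fun k => by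
    rw [← hElaw k, Measure.map_apply (hE k) measurableSet_Ioi]
  have hne : expMeasure r (Set.Ioi 1) ≠ 0 := by
    intro h
    have h1 := expMeasure_real_Ioi hr zero_le_one
    rw [measureReal_def, h, ENNReal.toReal_zero] at h1
    exact (Real.exp_pos _).ne h1
  have hlim := measure_limsup_eq_one hs hind (by
    simp_rw [hconst]
    exact ENNReal.tsum_const_eq_top_of_ne_zero hne)
  have hae : ∀ᵐ ω ∂P, ω ∈ limsup (fun k => E k ⁻¹' Set.Ioi 1) atTop :=
    (prob_compl_eq_zero_iff (MeasurableSet.measurableSet_limsup hs)).2 hlim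
  filter_upwards [hae, ae_interarrival_pos hr hE hElaw] with ω h1 h2
  rw [mem_limsup_iff_frequently_mem] at h1
  refine (not_summable_iff_tendsto_nat_atTop_of_nonneg fun k => (h2 k).le).1 fun hsum => ?_
  refine h1 ((hsum.tendsto_atTop_zero.eventually_lt_const zero_lt_one).mono fun k hk => ?_)
  simpa using hk.le

/-- The interarrival times are almost surely a measurable function of the counting process. -/
lemma indepFun_interarrival {M : ℝ≥0 → Ω → ℕ} (hEpos : ∀ᵐ ω ∂P, ∀ k, 0 < E k ω)
    (hS : ∀ᵐ ω ∂P, Tendsto (arrivalTime fun k => E k ω) atTop atTop)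
    (hME : ∀ᵐ ω ∂P, ∀ s : ℝ≥0,
      M s ω = Set.ncard {n : ℕ | arrivalTime (fun k => E k ω) (n + 1) ≤ (s : ℝ)})
    (hMW : IndepFun (fun ω (s : ℝ≥0) => M s ω) (fun ω (k : ℕ) => W k ω) P) :
    IndepFun (fun ω k => E k ω) (fun ω k => W k ω) P := by
  -- The `n`-th arrival time is the first time the count reaches `n`; rational times suffice by
  -- density and keep the infimum countable, hence measurable in the path.
  let g : ℕ → (ℝ≥0 → ℕ) → ℝ≥0∞ := fun n m =>
    ⨅ q : ℚ≥0, if n ≤ m (q : ℝ≥0) then ((q : ℝ≥0) : ℝ≥0∞) else ⊤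
  have hg : ∀ n, Measurable (g n) := fun n => by
    refine Measurable.iInf fun q => Measurable.ite ?_ measurable_const measurable_const
    exact measurable_pi_apply (q : ℝ≥0) (measurableSet_Ici (a := n))
  have hG : Measurable fun (m : ℝ≥0 → ℕ) (k : ℕ) => (g (k + 1) m).toReal - (g k m).toReal := by
    refine measurable_pi_lambda _ fun k => ?_
    have h1 := hg (k + 1)
    have h2 := hg k
    fun_prop
  refine (hMW.comp hG measurable_id).congr ?_ EventuallyEq.rfl
  filter_upwards [hEpos, hS, hME] with ω h1 h2 h3
  have key : ∀ n, g n (fun s => M s ω) = ENNReal.ofReal (arrivalTime (fun k => E k ω) n) := by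
    intro n
    have hiff : ∀ s : ℝ≥0, n ≤ M s ω ↔ arrivalTime (fun k => E k ω) n ≤ s := by
      intro s
      obtain ⟨j, hj1, hj2⟩ := exists_arrivalTime_le_lt h2 s.coe_nonneg
      rw [h3 s, ncard_arrivalTime_le h1 hj1 hj2]
      have hmono := arrivalTime_strictMono h1
      constructor
      · exact fun h => (hmono.monotone h).trans hj1
      · intro h
        have := hmono.lt_iff_lt.1 (h.trans_lt hj2)
        omega
    apply le_antisymm
    · refine le_of_forall_gt_imp_ge_of_dense fun b hb => ?_
      obtain ⟨q, hq1, hq2⟩ := ENNReal.lt_iff_exists_rat_btwn.1 hb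
      obtain ⟨hq2, hq3⟩ := hq2
      lift q to ℚ≥0 using hq1
      have hcoe : (Real.toNNReal ((q : ℚ) : ℝ)) = (q : ℝ≥0) := by
        ext
        rw [Real.coe_toNNReal _ (by exact_mod_cast q.cast_nonneg)]
        rfl
      rw [hcoe] at hq2 hq3
      refine iInf_le_of_le q ?_
      rw [if_pos ((hiff _).2 ?_)]
      · exact hq3.le
      · rw [← ENNReal.ofReal_coe_nnreal] at hq2
        exact ((ENNReal.ofReal_lt_ofReal_iff_of_nonneg (arrivalTime_nonneg h1 n)).1 hq2).le
    · refine le_iInf fun q => ?_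
      split_ifs with h
      · rw [← ENNReal.ofReal_coe_nnreal]
        exact ENNReal.ofReal_le_ofReal ((hiff _).1 h)
      · exact le_top
  ext k
  simp only [Function.comp, key, ENNReal.toReal_ofReal (arrivalTime_nonneg h1 _)]
  rw [arrivalTime_succ, add_sub_cancel_left]

/-- Fubini on the event that ruin precedes the horizon. The measurable version `τ` is needed because
`ruinTime`, an uncountable infimum, is controlled only almost surely. -/
lemma expHorizonRuinProb_eq_integral [IsProbabilityMeasure P] {M : ℝ≥0 → Ω → ℕ}
    {τ : Ω → ℝ≥0∞} {t : ℝ} (ht : 0 < t) (hτm : Measurable τ) (hτ : ∀ᵐ ω ∂P, ruinTime M W c u ω = τ ω) :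
    expHorizonRuinProb P M W c u t = ∫ ω, expSurvival (1 / t) (τ ω) ∂P := by
  have hδ : 0 < 1 / t := by positivity
  have hP := isProbabilityMeasure_expMeasure hδ
  have hset : MeasurableSet {x : ℝ × Ω | τ x.2 ≤ ENNReal.ofReal x.1} :=
    measurableSet_le (by fun_prop) (by fun_prop)
  have h1 : ∀ s, ruinProb P M W c u s =
      ∫ ω, {x : ℝ × Ω | τ x.2 ≤ ENNReal.ofReal x.1}.indicator 1 (s, ω) ∂P := by
    intro s
    have hs : MeasurableSet {ω | τ ω ≤ ENNReal.ofReal s} := measurableSet_le hτm measurable_const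
    have : {ω | ruinTime M W c u ω ≤ ENNReal.ofReal s} =ᵐ[P] {ω | τ ω ≤ ENNReal.ofReal s} := by
      filter_upwards [hτ] with ω h
      exact congrArg (· ≤ ENNReal.ofReal s) h
    rw [ruinProb, measureReal_congr this, ← integral_indicator_one hs]
    rfl
  have h2 : ∀ ω, expSurvival (1 / t) (τ ω) =
      ∫ s, {x : ℝ × Ω | τ x.2 ≤ ENNReal.ofReal x.1}.indicator 1 (s, ω) ∂expMeasure (1 / t) := by
    intro ω
    have hs : MeasurableSet {s : ℝ | τ ω ≤ ENNReal.ofReal s} :=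
      measurableSet_le measurable_const (by fun_prop)
    rw [← expMeasure_real_le_ofReal hδ, ← integral_indicator_one hs]
    rfl
  simp only [expHorizonRuinProb, h1, h2]
  exact integral_integral_swap ((integrable_const (1 : ℝ)).indicator hset)

end Renewal

end MinerRuin

/-! ### Assembly of the result -/

theorem theorem5p5 {Ω : Type*} [MeasurableSpace Ω] (P : Measure Ω) [IsProbabilityMeasure P]
    (p μ c t : ℝ) (hp : 0 < p) (hp1 : p < 1) (hμ : 0 < μ) (hc : 0 < c) (ht : 0 < t)
    (M : ℝ≥0 → Ω → ℕ) (W : ℕ → Ω → ℝ)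
    (hM : MinerRuin.IsPoissonProcess M (p * μ) P)
    (hWmeas : ∀ k, Measurable (W k))
    (hWpos : ∀ k, ∀ᵐ ω ∂P, 0 < W k ω)
    (hWindep : iIndepFun W P)
    (hWident : ∀ k, IdentDistrib (W k) (W 0) P P)
    (hWint : Integrable (W 0) P)
    (hMW : IndepFun (fun ω (s : ℝ≥0) => M s ω) (fun ω (k : ℕ) => W k ω) P)
    (hprofit : c < p * μ * ∫ ω, W 0 ω ∂P) :
    ∃ R : ℝ,
      (0 < R ∧ p * μ + 1 / t - c * R = p * μ * ∫ ω, Real.exp (-R * W 0 ω) ∂P) ∧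
      (∀ R' : ℝ, 0 < R' →
        p * μ + 1 / t - c * R' = p * μ * ∫ ω, Real.exp (-R' * W 0 ω) ∂P → R' = R) ∧
      ∀ u : ℝ, 0 ≤ u →
        MinerRuin.expHorizonRuinProb P M W c u t = Real.exp (-R * u) := by
  have hr : 0 < p * μ := mul_pos hp hμ
  have hδ : 0 < 1 / t := one_div_pos.2 ht
  obtain ⟨-, E, hE, hEi, hElaw, hME⟩ := hM
  have hWpos' : ∀ᵐ ω ∂P, ∀ k, 0 < W k ω := ae_all_iff.2 hWpos
  have hEpos := MinerRuin.ae_interarrival_pos hr hE hElaw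
  have hS := MinerRuin.ae_tendsto_arrivalTime hr hE hEi hElaw
  have hEWseq := MinerRuin.indepFun_interarrival hEpos hS hME hMW
  have hEW := MinerRuin.iIndepFun_prodMk_of_indepFun hE hWmeas hEi hWindep hEWseq
  have hEWk : ∀ k, IndepFun (E k) (W k) P := fun k =>
    hEWseq.comp (measurable_pi_apply k) (measurable_pi_apply k)
  have hνP : IsProbabilityMeasure (P.map (W 0)) :=
    Measure.isProbabilityMeasure_map (hWmeas 0).aemeasurable
  have hνpos : ∀ᵐ w ∂P.map (W 0), 0 < w := by
    rw [ae_map_iff (hWmeas 0).aemeasurable measurableSet_Ioi]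
    exact hWpos 0
  have hmap : ∀ R : ℝ, ∫ w, Real.exp (-R * w) ∂P.map (W 0) = ∫ ω, Real.exp (-R * W 0 ω) ∂P :=
    fun R => integral_map (hWmeas 0).aemeasurable (by fun_prop)
  obtain ⟨R, ⟨hR, hroot⟩, huniq⟩ := MinerRuin.existsUnique_lundberg_root hνpos hr hδ hc
  simp only [hmap] at hroot huniq
  refine ⟨R, ⟨hR, hroot⟩, fun R' h1 h2 => huniq R' ⟨h1, h2⟩, fun u hu => ?_⟩
  rw [MinerRuin.expHorizonRuinProb_eq_integral ht
    (MinerRuin.measurable_ruinTimeOfGaps (c := c) (u := u) hE hWmeas) (by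
      filter_upwards [hEpos, hS, hME] with ω h1 h2 h3
      exact MinerRuin.iInf_surplus_neg_eq hc h1 h2 h3)]
  -- The expectations converge to the Laplace transform of the ruin time, yet each of them equals
  -- `exp (-R u)`.
  have hlim := tendsto_integral_of_dominated_convergence (μ := P)
    (F := fun n ω => MinerRuin.discountedValue c u (1 / t) R (fun k => E k ω) (fun k => W k ω) n)
    (f := fun ω => MinerRuin.expSurvival (1 / t)
      (MinerRuin.ruinTimeOfGaps c u (fun k => E k ω) (fun k => W k ω)))
    (fun _ => 1)
    (fun n => (MinerRuin.measurable_discountedValue hE hWmeas n).aestronglyMeasurable)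
    (integrable_const _)
    (fun n => by
      filter_upwards [hEpos, hWpos'] with ω h1 h2
      exact MinerRuin.abs_discountedValue_le hc hδ hR hu h1 h2 n)
    (by
      filter_upwards [hEpos, hWpos', hS] with ω h1 h2 h3
      exact MinerRuin.tendsto_discountedValue hc hδ hR hu h1 h2 h3)
  simp only [MinerRuin.integral_discountedValue hr hc hδ hR hu hE hWmeas hEW hEWk hElaw
    (fun k => (hWident k).map_eq) hEpos hWpos' hroot] at hlim
  exact tendsto_nhds_unique hlim tendsto_const_nhds
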